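/- Let $V$ be a finite-dimensional real Euclidean space and let $\mathcal{A}$ be a central hyperplane arrangement in $V$, i.e. a finite set of linear hyperplanes of $V$. The \emph{regions} of $\mathcal{A}$ are the closures of the connected components of $V \setminus \bigcup_{H\in\mathcal{A}} H$, and the \emph{faces} of $\mathcal{A}$ are the intersections of nonempty families of regions. Fix a base region $B$. For a region $R$ let $S(B,R)$ be the set of hyperplanes $H\in\mathcal{A}$ that separate $B$ from $R$. The \emph{poset of regions} $\mathrm{PR}(\mathcal{A},B)$ is the set of regions ordered by $$R \le R' \iff S(B,R)\subseteq S(B,R').$$ For every face $F$, the set of regions containing $F$ is an interval $[m_F,M_F]$ of $\mathrm{PR}(\mathcal{A},B)$. The \emph{facial weak order} $\mathrm{FW}(\mathcal{A},B)$ is the set of all faces of $\mathcal{A}$ ordered by $$F \le G \iff m_F \le m_G \text{ and } M_F \le M_G \text{ in } \mathrm{PR}(\mathcal{A},B).$$ \textbf{Theorem.} If $\mathrm{PR}(\mathcal{A},B)$ is a lattice, then $\mathrm{FW}(\mathcal{A},B)$ is a lattice. -/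

import Mathlib

/-- A poset is a lattice when every two elements have a least upper bound (join) and a greatest
lower bound (meet). -/
def IsLatticePoset (P : Type*) [PartialOrder P] : Prop :=
  ∀ x y : P, (∃ j, IsLUB {x, y} j) ∧ (∃ m, IsGLB {x, y} m)

/-- A central hyperplane arrangement in the real inner product space `V`: a finite set of linear
hyperplanes, i.e. of linear subspaces of codimension one. -/
structure CentralArrangement (V : Type*) [NormedAddCommGroup V] [InnerProductSpace ℝ V] where
  hyperplanes : Finset (Submodule ℝ V)
  isHyperplane : ∀ H ∈ hyperplanes, Module.finrank ℝ H + 1 = Module.finrank ℝ V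

namespace CentralArrangement

section Basic

variable {V : Type*} [NormedAddCommGroup V] [InnerProductSpace ℝ V]

/-- The complement in `V` of the union of the hyperplanes. -/
def complement (A : CentralArrangement V) : Set V :=
  (⋃ H ∈ A.hyperplanes, (H : Set V))ᶜ

/-- Regions are the closures of the connected components of the complement. -/
def IsRegion (A : CentralArrangement V) (R : Set V) : Prop :=
  ∃ x ∈ A.complement, R = closure (connectedComponentIn A.complement x)

/-- The set of regions. -/
def Region (A : CentralArrangement V) : Type _ := {R : Set V // A.IsRegion R}

/-- Faces are the intersections of nonempty families of regions. -/
def IsFace (A : CentralArrangement V) (F : Set V) : Prop :=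
  ∃ S : Set (Set V), S.Nonempty ∧ (∀ R ∈ S, A.IsRegion R) ∧ F = ⋂₀ S

/-- The set of faces. -/
def Face (A : CentralArrangement V) : Type _ := {F : Set V // A.IsFace F}

/-- The hyperplane `H` separates `R` from `R'`: they lie in the two opposite closed half-spaces
bounded by `H` (here `e` is a normal vector to `H`). -/
def Separates (H : Submodule ℝ V) (R R' : Set V) : Prop :=
  ∃ e ∈ Hᗮ, e ≠ 0 ∧ (∀ x ∈ R, 0 ≤ inner ℝ e x) ∧ (∀ y ∈ R', inner ℝ e y ≤ 0)

/-- The separation set `S(R, R')`. -/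
def sepSet (A : CentralArrangement V) (R R' : A.Region) : Set (Submodule ℝ V) :=
  {H | H ∈ A.hyperplanes ∧ Separates H R.1 R'.1}

/-- The regions, as the underlying set of the poset of regions with base region `B`. -/
def PosetOfRegions (A : CentralArrangement V) (_B : A.Region) : Type _ := A.Region

/-- The faces, as the underlying set of the facial weak order with base region `B`. -/
def FacialWeakOrder (A : CentralArrangement V) (_B : A.Region) : Type _ := A.Face

end Basic

/-! ### Regions as sign cells -/

section Cells

variable {V : Type*} [NormedAddCommGroup V] [InnerProductSpace ℝ V] [FiniteDimensional ℝ V]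

theorem exists_normal (A : CentralArrangement V) (H : Submodule ℝ V) :
    ∃ e : V, H ∈ A.hyperplanes → e ≠ 0 ∧ Hᗮ = Submodule.span ℝ {e} := by
  by_cases hH : H ∈ A.hyperplanes
  · have h1 := A.isHyperplane H hH
    have h2 := Submodule.finrank_add_finrank_orthogonal H
    have h3 : Module.finrank ℝ Hᗮ = 1 := by omega
    obtain ⟨v, hv, hs⟩ := finrank_eq_one_iff'.1 h3
    refine ⟨v, fun _ => ⟨fun h => hv (Subtype.ext h), ?_⟩⟩
    ext w
    rw [Submodule.mem_span_singleton]
    constructor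
    · intro hw
      obtain ⟨c, hc⟩ := hs ⟨w, hw⟩
      exact ⟨c, congrArg Subtype.val hc⟩
    · rintro ⟨c, rfl⟩
      exact Submodule.smul_mem _ _ v.2
  · exact ⟨0, fun h => absurd h hH⟩

/-- A chosen nonzero normal vector to each hyperplane. -/
noncomputable def normal (A : CentralArrangement V) (H : Submodule ℝ V) : V :=
  (A.exists_normal H).choose

theorem normal_ne_zero (A : CentralArrangement V) {H : Submodule ℝ V}
    (hH : H ∈ A.hyperplanes) : A.normal H ≠ 0 :=
  ((A.exists_normal H).choose_spec hH).1

theorem orthogonal_eq (A : CentralArrangement V) {H : Submodule ℝ V}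
    (hH : H ∈ A.hyperplanes) : Hᗮ = Submodule.span ℝ {A.normal H} :=
  ((A.exists_normal H).choose_spec hH).2

/-- The linear functional given by the chosen normal vector. -/
noncomputable def nf (A : CentralArrangement V) (H : Submodule ℝ V) : V →L[ℝ] ℝ :=
  innerSL ℝ (A.normal H)

theorem nf_eq_zero_iff (A : CentralArrangement V) {H : Submodule ℝ V} (hH : H ∈ A.hyperplanes)
    (x : V) : A.nf H x = 0 ↔ x ∈ H := by
  have h : x ∈ H ↔ x ∈ (Submodule.span ℝ {A.normal H})ᗮ := by
    rw [← A.orthogonal_eq hH, Submodule.orthogonal_orthogonal]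
  rw [h, Submodule.mem_orthogonal_singleton_iff_inner_right]
  rfl

theorem mem_complement_iff (A : CentralArrangement V) {x : V} :
    x ∈ A.complement ↔ ∀ H ∈ A.hyperplanes, A.nf H x ≠ 0 := by
  simp only [complement, Set.mem_compl_iff, Set.mem_iUnion, not_exists, SetLike.mem_coe]
  exact forall₂_congr fun H hH => not_congr (A.nf_eq_zero_iff hH x).symm

/-- The closed cell of `x`: the points weakly on the same side as `x` of every hyperplane. -/
def cell (A : CentralArrangement V) (x : V) : Set V :=
  {y | ∀ H ∈ A.hyperplanes, 0 ≤ A.nf H x * A.nf H y}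

theorem component_eq (A : CentralArrangement V) {x : V} (hx : x ∈ A.complement) :
    connectedComponentIn A.complement x =
      {y | ∀ H ∈ A.hyperplanes, 0 < A.nf H x * A.nf H y} := by
  have hx' := A.mem_complement_iff.1 hx
  apply Set.Subset.antisymm
  · intro y hy H hH
    by_contra hneg
    push Not at hneg
    have hc : ContinuousOn (fun z => A.nf H x * A.nf H z)
        (connectedComponentIn A.complement x) := by fun_prop
    have h0 : (0 : ℝ) ∈ Set.Icc (A.nf H x * A.nf H y) (A.nf H x * A.nf H x) :=
      ⟨hneg, mul_self_nonneg _⟩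
    obtain ⟨z, hz, hz0⟩ := isPreconnected_connectedComponentIn.intermediate_value hy
      (mem_connectedComponentIn hx) hc h0
    have hz' := A.mem_complement_iff.1 (connectedComponentIn_subset _ _ hz) H hH
    exact mul_ne_zero (hx' H hH) hz' hz0
  · apply IsPreconnected.subset_connectedComponentIn
    · apply Convex.isPreconnected
      intro y hy z hz a b ha hb hab H hH
      have h1 := hy H hH
      have h2 := hz H hH
      simp only [map_add, map_smul, smul_eq_mul]
      rcases ha.eq_or_lt with rfl | ha
      · have : b = 1 := by linarith
        subst this
        simpa using h2
      · have : 0 < a * (A.nf H x * A.nf H y) + b * (A.nf H x * A.nf H z) := by positivity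
        linarith
    · intro H hH
      exact mul_self_pos.2 (hx' H hH)
    · intro y hy
      rw [mem_complement_iff]
      intro H hH h
      have := hy H hH
      simp [h] at this

theorem closure_component (A : CentralArrangement V) {x : V} (hx : x ∈ A.complement) :
    closure (connectedComponentIn A.complement x) = A.cell x := by
  rw [A.component_eq hx]
  apply Set.Subset.antisymm
  · apply closure_minimal
    · exact fun y hy H hH => (hy H hH).le
    · have : A.cell x = ⋂ H ∈ A.hyperplanes, {y | 0 ≤ A.nf H x * A.nf H y} := by
        ext y; simp [cell]
      rw [this]
      exact isClosed_biInter fun H _ => isClosed_le continuous_const (by fun_prop)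
  · intro y hy
    have ht : Filter.Tendsto (fun t : ℝ => y + t • x) (nhdsWithin 0 (Set.Ioi 0)) (nhds y) := by
      have : Continuous fun t : ℝ => y + t • x := by fun_prop
      simpa using (this.tendsto 0).mono_left nhdsWithin_le_nhds
    refine mem_closure_of_tendsto ht ?_
    filter_upwards [self_mem_nhdsWithin] with t ht H hH
    have h1 := hy H hH
    have h2 := mul_self_pos.2 (A.mem_complement_iff.1 hx H hH)
    have h3 : 0 < t * (A.nf H x * A.nf H x) := mul_pos ht h2
    simp only [map_add, map_smul, smul_eq_mul]
    linarith

theorem isRegion_iff (A : CentralArrangement V) {R : Set V} :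
    A.IsRegion R ↔ ∃ x ∈ A.complement, R = A.cell x := by
  unfold IsRegion
  exact exists_congr fun x => and_congr_right fun hx => by rw [A.closure_component hx]

theorem self_mem_cell (A : CentralArrangement V) (x : V) : x ∈ A.cell x :=
  fun _ _ => mul_self_nonneg _

theorem separates_cell_iff (A : CentralArrangement V) {x z : V} (hx : x ∈ A.complement)
    (hz : z ∈ A.complement) {H : Submodule ℝ V} (hH : H ∈ A.hyperplanes) :
    Separates H (A.cell x) (A.cell z) ↔ A.nf H x * A.nf H z < 0 := by
  have hx' := A.mem_complement_iff.1 hx H hH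
  have hz' := A.mem_complement_iff.1 hz H hH
  have hs := A.orthogonal_eq hH
  constructor
  · rintro ⟨e, he, he0, h1, h2⟩
    rw [hs, Submodule.mem_span_singleton] at he
    obtain ⟨c, rfl⟩ := he
    have e1 := h1 x (A.self_mem_cell x)
    have e2 := h2 z (A.self_mem_cell z)
    rw [real_inner_smul_left] at e1 e2
    change 0 ≤ c * A.nf H x at e1
    change c * A.nf H z ≤ 0 at e2
    have hc : c ≠ 0 := by rintro rfl; simp at he0
    refine lt_of_le_of_ne ?_ (mul_ne_zero hx' hz')
    have hc2 : 0 < c * c := mul_self_pos.2 hc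
    by_contra hneg
    push Not at hneg
    have := mul_nonneg e1 (neg_nonneg.2 e2)
    nlinarith [mul_pos hc2 hneg]
  · intro hlt
    refine ⟨A.nf H x • A.normal H, ?_, ?_, ?_, ?_⟩
    · rw [hs]
      exact Submodule.smul_mem _ _ (Submodule.mem_span_singleton_self _)
    · exact smul_ne_zero hx' (A.normal_ne_zero hH)
    · intro y hy
      rw [real_inner_smul_left]
      exact hy H hH
    · intro y hy
      rw [real_inner_smul_left]
      change A.nf H x * A.nf H y ≤ 0
      have h1 := hy H hH
      by_contra hneg
      push Not at hneg
      nlinarith [mul_nonneg h1 hneg.le, mul_self_pos.2 (right_ne_zero_of_mul hneg.ne'),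
        mul_pos (neg_pos.2 hlt) (mul_self_pos.2 (right_ne_zero_of_mul hneg.ne'))]

theorem sepSet_subset_iff (A : CentralArrangement V) {b x z : V} (hb : b ∈ A.complement)
    (hx : x ∈ A.complement) (hz : z ∈ A.complement) {B R R' : A.Region}
    (hB : B.1 = A.cell b) (hR : R.1 = A.cell x) (hR' : R'.1 = A.cell z) :
    A.sepSet B R ⊆ A.sepSet B R' ↔ ∀ H ∈ A.hyperplanes,
      A.nf H b * A.nf H x < 0 → A.nf H b * A.nf H z < 0 := by
  constructor
  · intro h H hH hlt
    have : H ∈ A.sepSet B R :=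
      ⟨hH, by rw [hB, hR]; exact (A.separates_cell_iff hb hx hH).2 hlt⟩
    have h2 := (h this).2
    rw [hB, hR'] at h2
    exact (A.separates_cell_iff hb hz hH).1 h2
  · rintro h H ⟨hH, hs⟩
    rw [hB, hR, A.separates_cell_iff hb hx hH] at hs
    exact ⟨hH, by rw [hB, hR']; exact (A.separates_cell_iff hb hz hH).2 (h H hH hs)⟩

theorem nonneg_trans {a b c : ℝ} (h1 : 0 < a * b) (h2 : 0 ≤ b * c) : 0 ≤ a * c := by
  have hb : 0 < b * b := mul_self_pos.2 (right_ne_zero_of_mul h1.ne')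
  have h3 : 0 ≤ (b * b) * (a * c) := by nlinarith [mul_nonneg h1.le h2]
  exact nonneg_of_mul_nonneg_right h3 hb

theorem nonneg_of_neg_of_neg {a b c : ℝ} (h1 : a * b < 0) (h2 : b * c ≤ 0) : 0 ≤ a * c := by
  have := nonneg_trans (a := -a) (b := b) (c := -c) (by linarith) (by linarith)
  linarith

theorem pos_of_nonneg {a b : ℝ} (ha : a ≠ 0) (hb : b ≠ 0) (h : 0 ≤ a * b) : 0 < a * b :=
  lt_of_le_of_ne h (mul_ne_zero ha hb).symm

end Cells

/-! ### The poset of regions -/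

section PosetOfRegions

variable {V : Type*} [NormedAddCommGroup V] [InnerProductSpace ℝ V] [FiniteDimensional ℝ V]

/-- The poset of regions: `R ≤ R'` if and only if `S(B, R) ⊆ S(B, R')`. -/
instance (A : CentralArrangement V) (B : A.Region) : PartialOrder (A.PosetOfRegions B) where
  le R R' := A.sepSet B R ⊆ A.sepSet B R'
  le_refl _ := Set.Subset.refl _
  le_trans _ _ _ h h' := Set.Subset.trans h h'
  le_antisymm R R' h h' := by
    obtain ⟨b, hb, hB⟩ := A.isRegion_iff.1 B.2
    obtain ⟨x, hx, hR⟩ := A.isRegion_iff.1 R.2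
    obtain ⟨z, hz, hR'⟩ := A.isRegion_iff.1 R'.2
    rw [A.sepSet_subset_iff hb hx hz hB hR hR'] at h
    rw [A.sepSet_subset_iff hb hz hx hB hR' hR] at h'
    have key : ∀ H ∈ A.hyperplanes, 0 < A.nf H x * A.nf H z := by
      intro H hH
      have b0 := A.mem_complement_iff.1 hb H hH
      have x0 := A.mem_complement_iff.1 hx H hH
      have z0 := A.mem_complement_iff.1 hz H hH
      apply pos_of_nonneg x0 z0
      by_cases hc : A.nf H b * A.nf H x < 0
      · exact nonneg_of_neg_of_neg (by rwa [mul_comm]) (h H hH hc).le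
      · have hc' : ¬ A.nf H b * A.nf H z < 0 := fun hn => hc (h' H hH hn)
        push Not at hc hc'
        exact nonneg_trans (by rw [mul_comm]; exact pos_of_nonneg b0 x0 hc) hc'
    apply Subtype.ext
    rw [hR, hR']
    ext y
    constructor
    · exact fun hy H hH => nonneg_trans (by rw [mul_comm]; exact key H hH) (hy H hH)
    · exact fun hy H hH => nonneg_trans (key H hH) (hy H hH)

end PosetOfRegions

/-! ### Facial intervals -/

section FacialIntervals

variable {V : Type*} [NormedAddCommGroup V] [InnerProductSpace ℝ V] [FiniteDimensional ℝ V]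

/-- The set of regions that contain the face `F`. -/
def regionsContaining (A : CentralArrangement V) (B : A.Region) (F : A.Face) :
    Set (A.PosetOfRegions B) := {R | F.1 ⊆ R.1}

/-- Every face has a point that lies in no hyperplane, except those containing the face. -/
theorem exists_generic (A : CentralArrangement V) (F : A.Face) :
    ∃ p : V, ∀ z : V, F.1 ⊆ A.cell z ↔ p ∈ A.cell z := by
  classical
  obtain ⟨S, ⟨R₀, hR₀⟩, hS, hF⟩ := F.2
  obtain ⟨x₀, hx₀, hRx⟩ := A.isRegion_iff.1 (hS R₀ hR₀)
  have hF0 : (0 : V) ∈ F.1 := by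
    rw [hF]
    intro R hR
    obtain ⟨x, _, rfl⟩ := A.isRegion_iff.1 (hS R hR)
    intro H _
    simp
  have hFadd : ∀ y ∈ F.1, ∀ z ∈ F.1, y + z ∈ F.1 := by
    intro y hy z hz
    rw [hF] at hy hz ⊢
    intro R hR
    have h1 := hy R hR
    have h2 := hz R hR
    obtain ⟨x, _, rfl⟩ := A.isRegion_iff.1 (hS R hR)
    intro H hH
    rw [map_add, mul_add]
    exact add_nonneg (h1 H hH) (h2 H hH)
  have hFx₀ : ∀ y ∈ F.1, ∀ H ∈ A.hyperplanes, 0 ≤ A.nf H x₀ * A.nf H y := by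
    intro y hy H hH
    rw [hF] at hy
    have := hy R₀ hR₀
    rw [hRx] at this
    exact this H hH
  have hch : ∀ H : Submodule ℝ V, ∃ y ∈ F.1, A.nf H y = 0 → ∀ y' ∈ F.1, A.nf H y' = 0 := by
    intro H
    by_cases h : ∃ y ∈ F.1, A.nf H y ≠ 0
    · obtain ⟨y, hy, hne⟩ := h
      exact ⟨y, hy, fun h0 => absurd h0 hne⟩
    · push Not at h
      exact ⟨0, hF0, fun _ => h⟩
  choose f hfF hf using hch
  have hp : ∑ H ∈ A.hyperplanes, f H ∈ F.1 :=
    Finset.sum_induction f (· ∈ F.1) (fun a b ha hb => hFadd a ha b hb) hF0 (fun H _ => hfF H)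
  refine ⟨∑ H ∈ A.hyperplanes, f H, fun z => ⟨fun h => h hp, fun h y hy H hH => ?_⟩⟩
  by_cases hy0 : A.nf H y = 0
  · simp [hy0]
  · have hx0 := A.mem_complement_iff.1 hx₀ H hH
    have hf0 : A.nf H (f H) ≠ 0 := fun h0 => hy0 (hf H h0 y hy)
    have h1 : 0 < A.nf H x₀ * A.nf H (∑ H ∈ A.hyperplanes, f H) := by
      rw [map_sum, Finset.mul_sum]
      exact Finset.sum_pos' (fun K _ => hFx₀ _ (hfF K) H hH)
        ⟨H, hH, pos_of_nonneg hx0 hf0 (hFx₀ _ (hfF H) H hH)⟩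
    have h2 := h H hH
    have h3 := hFx₀ y hy H hH
    have h4 := nonneg_trans h1 (by rw [mul_comm]; exact h2)
    have h5 : 0 < A.nf H y * A.nf H x₀ := by
      rw [mul_comm]; exact pos_of_nonneg hx0 hy0 h3
    rw [mul_comm]
    exact nonneg_trans h5 h4

/-- Moving a little from `p` in the direction `b` does not cross any hyperplane. -/
theorem exists_perturb (A : CentralArrangement V) (p b : V) :
    ∃ t : ℝ, 0 < t ∧ ∀ H ∈ A.hyperplanes, A.nf H p ≠ 0 →
      0 < A.nf H p * A.nf H (p + t • b) := by
  have : ∀ᶠ t : ℝ in nhdsWithin 0 (Set.Ioi 0), ∀ H ∈ A.hyperplanes, A.nf H p ≠ 0 →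
      0 < A.nf H p * A.nf H (p + t • b) := by
    rw [Filter.eventually_all_finset]
    intro H _
    by_cases h0 : A.nf H p = 0
    · simp [h0]
    · have hc : Continuous fun t : ℝ => A.nf H p * A.nf H (p + t • b) := by fun_prop
      have h1 : 0 < A.nf H p * A.nf H (p + (0 : ℝ) • b) := by
        simpa using mul_self_pos.2 h0
      filter_upwards [nhdsWithin_le_nhds (hc.continuousAt.eventually (lt_mem_nhds h1))]
        with t ht _
      exact ht
  obtain ⟨t, ht, ht0⟩ := (this.and self_mem_nhdsWithin).exists
  exact ⟨t, ht0, ht⟩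

theorem exists_isLeast (A : CentralArrangement V) (B : A.Region) (F : A.Face) :
    ∃ R, IsLeast (A.regionsContaining B F) R := by
  obtain ⟨p, hp⟩ := A.exists_generic F
  obtain ⟨b, hb, hB⟩ := A.isRegion_iff.1 B.2
  obtain ⟨t, ht, hpt⟩ := A.exists_perturb p b
  have hb' := A.mem_complement_iff.1 hb
  have hq0 : ∀ H ∈ A.hyperplanes, A.nf H p = 0 → 0 < A.nf H b * A.nf H (p + t • b) := by
    intro H hH h
    have := mul_pos ht (mul_self_pos.2 (hb' H hH))
    simp only [map_add, map_smul, smul_eq_mul, h]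
    linarith
  have hq : p + t • b ∈ A.complement := by
    rw [mem_complement_iff]
    intro H hH
    by_cases h : A.nf H p = 0
    · exact right_ne_zero_of_mul (hq0 H hH h).ne'
    · exact right_ne_zero_of_mul (hpt H hH h).ne'
  refine ⟨(⟨A.cell (p + t • b), A.isRegion_iff.2 ⟨_, hq, rfl⟩⟩ : A.Region), ?_, ?_⟩
  · refine (hp _).2 fun H hH => ?_
    by_cases h : A.nf H p = 0
    · simp [h]
    · rw [mul_comm]; exact (hpt H hH h).le
  · intro R hR
    obtain ⟨z, hz, hRz⟩ := A.isRegion_iff.1 R.2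
    have hpz : p ∈ A.cell z := (hp z).1 (hRz ▸ hR)
    refine (A.sepSet_subset_iff hb hq hz hB rfl hRz).2 fun H hH hlt => ?_
    have hz' := A.mem_complement_iff.1 hz H hH
    have h : A.nf H p ≠ 0 := fun h => absurd (hq0 H hH h) (not_lt.2 hlt.le)
    have h1 : 0 ≤ A.nf H (p + t • b) * A.nf H z :=
      nonneg_trans (by rw [mul_comm]; exact hpt H hH h) (by rw [mul_comm]; exact hpz H hH)
    by_contra hneg
    push Not at hneg
    have h2 := nonneg_trans (pos_of_nonneg (hb' H hH) hz' hneg) (by rw [mul_comm]; exact h1)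
    linarith

theorem exists_isGreatest (A : CentralArrangement V) (B : A.Region) (F : A.Face) :
    ∃ R, IsGreatest (A.regionsContaining B F) R := by
  obtain ⟨p, hp⟩ := A.exists_generic F
  obtain ⟨b, hb, hB⟩ := A.isRegion_iff.1 B.2
  obtain ⟨t, ht, hpt⟩ := A.exists_perturb p (-b)
  have hb' := A.mem_complement_iff.1 hb
  have hq0 : ∀ H ∈ A.hyperplanes, A.nf H p = 0 → A.nf H b * A.nf H (p + t • (-b)) < 0 := by
    intro H hH h
    have := mul_pos ht (mul_self_pos.2 (hb' H hH))
    simp only [map_add, map_smul, smul_eq_mul, h, map_neg]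
    linarith
  have hq : p + t • (-b) ∈ A.complement := by
    rw [mem_complement_iff]
    intro H hH
    by_cases h : A.nf H p = 0
    · exact right_ne_zero_of_mul (hq0 H hH h).ne
    · exact right_ne_zero_of_mul (hpt H hH h).ne'
  refine ⟨(⟨A.cell (p + t • (-b)), A.isRegion_iff.2 ⟨_, hq, rfl⟩⟩ : A.Region), ?_, ?_⟩
  · refine (hp _).2 fun H hH => ?_
    by_cases h : A.nf H p = 0
    · simp [h]
    · rw [mul_comm]; exact (hpt H hH h).le
  · intro R hR
    obtain ⟨z, hz, hRz⟩ := A.isRegion_iff.1 R.2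
    have hpz : p ∈ A.cell z := (hp z).1 (hRz ▸ hR)
    refine (A.sepSet_subset_iff hb hz hq hB hRz rfl).2 fun H hH hlt => ?_
    by_cases h : A.nf H p = 0
    · exact hq0 H hH h
    · have hz' := A.mem_complement_iff.1 hz H hH
      have hq' := A.mem_complement_iff.1 hq H hH
      have h1 : 0 ≤ A.nf H (p + t • (-b)) * A.nf H z :=
        nonneg_trans (by rw [mul_comm]; exact hpt H hH h) (by rw [mul_comm]; exact hpz H hH)
      by_contra hneg
      push Not at hneg
      have h2 := nonneg_trans (pos_of_nonneg (hb' H hH) hq' hneg) h1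
      linarith

/-- The lower bound `m_F` of the facial interval of `F`: the least region containing `F`. -/
noncomputable def lower (A : CentralArrangement V) (B : A.Region) (F : A.Face) :
    A.PosetOfRegions B := (A.exists_isLeast B F).choose

/-- The upper bound `M_F` of the facial interval of `F`: the greatest region containing `F`. -/
noncomputable def upper (A : CentralArrangement V) (B : A.Region) (F : A.Face) :
    A.PosetOfRegions B := (A.exists_isGreatest B F).choose

/-- The regions containing a face `F` form the interval `[m_F, M_F]` of the poset of regions. -/
theorem regionsContaining_eq_Icc (A : CentralArrangement V) (B : A.Region) (F : A.Face) :
    A.regionsContaining B F = Set.Icc (A.lower B F) (A.upper B F) := by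
  have hm := (A.exists_isLeast B F).choose_spec
  have hM := (A.exists_isGreatest B F).choose_spec
  apply Set.Subset.antisymm
  · exact fun R hR => ⟨hm.2 hR, hM.2 hR⟩
  · rintro R ⟨h1, h2⟩ y hy
    have hym : y ∈ (A.lower B F).1 := hm.1 hy
    have hyM : y ∈ (A.upper B F).1 := hM.1 hy
    obtain ⟨b, hb, hB⟩ := A.isRegion_iff.1 B.2
    obtain ⟨z, hz, hRz⟩ := A.isRegion_iff.1 R.2
    obtain ⟨m, hm', hmz⟩ := A.isRegion_iff.1 (A.lower B F).2
    obtain ⟨M, hM', hMz⟩ := A.isRegion_iff.1 (A.upper B F).2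
    have h1' := (A.sepSet_subset_iff hb hm' hz hB hmz hRz).1 h1
    have h2' := (A.sepSet_subset_iff hb hz hM' hB hRz hMz).1 h2
    rw [hmz] at hym
    rw [hMz] at hyM
    rw [hRz]
    intro H hH
    have b0 := A.mem_complement_iff.1 hb H hH
    have z0 := A.mem_complement_iff.1 hz H hH
    have m0 := A.mem_complement_iff.1 hm' H hH
    by_cases hc : A.nf H b * A.nf H z < 0
    · have h3 := nonneg_trans (a := -A.nf H b) (by linarith [h2' H hH hc]) (hyM H hH)
      exact nonneg_of_neg_of_neg (by rwa [mul_comm]) (by linarith)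
    · have hc' : ¬ A.nf H b * A.nf H m < 0 := fun h => hc (h1' H hH h)
      push Not at hc hc'
      have h3 := nonneg_trans (pos_of_nonneg b0 m0 hc') (hym H hH)
      exact nonneg_trans (by rw [mul_comm]; exact pos_of_nonneg b0 z0 hc) h3

theorem face_ext (A : CentralArrangement V) (B : A.Region) {F G : A.Face}
    (h1 : A.lower B F = A.lower B G) (h2 : A.upper B F = A.upper B G) : F = G := by
  have hsub : ∀ F G : A.Face, A.lower B F = A.lower B G → A.upper B F = A.upper B G →
      F.1 ⊆ G.1 := by
    intro F G h1 h2 y hy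
    obtain ⟨S, _, hS, hG⟩ := G.2
    rw [hG]
    intro R hR
    have hmem : (⟨R, hS R hR⟩ : A.Region) ∈ A.regionsContaining B G := by
      change G.1 ⊆ R
      rw [hG]
      exact Set.sInter_subset_of_mem hR
    rw [A.regionsContaining_eq_Icc B G, ← h1, ← h2, ← A.regionsContaining_eq_Icc B F] at hmem
    exact hmem hy
  exact Subtype.ext (Set.Subset.antisymm (hsub F G h1 h2) (hsub G F h1.symm h2.symm))

/-- The facial weak order: `F ≤ G` if and only if `m_F ≤ m_G` and `M_F ≤ M_G` in the poset of
regions. -/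
instance (A : CentralArrangement V) (B : A.Region) : PartialOrder (A.FacialWeakOrder B) where
  le F G := A.lower B F ≤ A.lower B G ∧ A.upper B F ≤ A.upper B G
  le_refl _ := ⟨le_refl _, le_refl _⟩
  le_trans _ _ _ h h' := ⟨h.1.trans h'.1, h.2.trans h'.2⟩
  le_antisymm _ _ h h' := A.face_ext B (le_antisymm h.1 h'.1) (le_antisymm h.2 h'.2)

end FacialIntervals

end CentralArrangement

/-!
Fix a point `b` inside the base region and scale the functionals defining the hyperplanes so that
they are positive at `b`. A face is then a sign vector, realised by a point of its relative
interior. The region `m_F` is obtained by replacing each `0` by `+`, the region `M_F` by replacing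
each `0` by `-`, so `F ≤ G` says that each sign of `G` is at most the corresponding sign of `F`
(`facialWeakOrder_le_iff`). As `x ↦ -x` reverses this order, it suffices to construct joins
(`exists_faceLE_join`).

Given points `x₁`, `x₂`, let `N` be the set of functionals negative at one of them and `Z` the set
of the remaining ones that vanish at one of them. A point `y` is an upper bound exactly if `y < 0`
on `N` and `y ≤ 0` on `Z`. Let `M` be the join of the two upper regions in the poset of regions.
Moving an upper bound slightly in the direction `-b` gives a region above `M`, so every upper bound
is `≤ 0` on the separation set of `M`.

Let `I ⊆ Z` consist of the functionals in `Z` that span extreme rays of the cone generated by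
`N ∪ Z` (`exists_extreme_generators`). For `i ∈ I` there is a region `T i` that is positive at `i`
and negative on the rest of `N ∪ Z`. For `K ⊆ I` take the meet `R` of `M` and of the `T i`, `i ∈ K`.
It is positive on `K` and wherever `M` is, and negative on `N` because the lower regions of `x₁` and
`x₂` lie below `M` and all the `T i`. It is also negative at each `j ∈ I \ K`: if `x₁`, say,
vanishes at `j`, the region reached from `x₁` by a small step in the direction `-T j` is below `M`
and all `T i` with `i ∈ K`, and is negative at `j`. So all sign patterns on `I` occur, and by
convexity (`exists_forall_eq_zero_of_orthants`) there is a point `w` that vanishes on `I`, is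
negative on `N` and is positive wherever `M` is.

This `w` is the join. It is an upper bound because the cone of `N ∪ I` contains `Z`. If `y` is
another upper bound, then so is `y + t (y - w)` for small `t > 0`, since `w` vanishes on `I`; as it
is `≤ 0` on the separation set of `M`, `y` is negative wherever `w` is.
-/

/-! ### Points of a vector space compared through finitely many functionals -/

section SignOrder

variable {V ι : Type*} [AddCommGroup V] [Module ℝ V]

/-- A point is generic when it lies on none of the hyperplanes `f i = 0`; generic points represent
regions. -/
def IsRegionPoint (f : ι → V →ₗ[ℝ] ℝ) (x : V) : Prop := ∀ i, f i x ≠ 0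

/-- The order of the poset of regions, read on representing points. The functionals are meant to be
positive on the base region, so that `{i | f i x < 0}` is the separation set of `x`. -/
def RegionLE (f : ι → V →ₗ[ℝ] ℝ) (x y : V) : Prop := ∀ i, f i x < 0 → f i y < 0

/-- The facial weak order, read on points in the relative interiors of faces: along the order the
sign of each functional moves from `+` through `0` to `-`. -/
def FaceLE (f : ι → V →ₗ[ℝ] ℝ) (x y : V) : Prop :=
  ∀ i, (f i x < 0 → f i y < 0) ∧ (f i x ≤ 0 → f i y ≤ 0)

/-- A small enough step from `x` in the direction `d` changes no nonzero sign. -/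
theorem exists_pos_smul_step [Finite ι] (f : ι → V →ₗ[ℝ] ℝ) (x d : V) :
    ∃ t : ℝ, 0 < t ∧ ∀ i, (f i x < 0 → f i (x + t • d) < 0) ∧
      (0 < f i x → 0 < f i (x + t • d)) := by
  have : ∀ᶠ t : ℝ in nhdsWithin 0 (Set.Ioi 0), ∀ i, (f i x < 0 → f i (x + t • d) < 0) ∧
      (0 < f i x → 0 < f i (x + t • d)) := by
    rw [Filter.eventually_all]
    intro i
    have hc : Filter.Tendsto (fun t : ℝ => f i (x + t • d)) (nhdsWithin 0 (Set.Ioi 0))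
        (nhds (f i x)) := by
      have h : Continuous fun t : ℝ => f i x + t * f i d := by fun_prop
      simpa using (h.tendsto 0).mono_left nhdsWithin_le_nhds
    rcases lt_trichotomy (f i x) 0 with h | h | h
    · filter_upwards [hc.eventually (gt_mem_nhds h)] with t ht
      exact ⟨fun _ => ht, fun h' => absurd h' h.not_gt⟩
    · exact Filter.Eventually.of_forall fun t =>
        ⟨fun h' => absurd h h'.ne, fun h' => absurd h h'.ne'⟩
    · filter_upwards [hc.eventually (lt_mem_nhds h)] with t ht
      exact ⟨fun h' => absurd h' h.not_gt, fun _ => ht⟩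
  obtain ⟨t, ht, ht0⟩ := (this.and self_mem_nhdsWithin).exists
  exact ⟨t, ht0, ht⟩

/-- Composition of covectors: the signs of the result are those of `x`, and those of `d` where `x`
vanishes. -/
theorem exists_composition [Finite ι] (f : ι → V →ₗ[ℝ] ℝ) (x d : V) :
    ∃ z : V, ∀ i, (f i z < 0 ↔ f i x < 0 ∨ f i x = 0 ∧ f i d < 0) ∧
      (0 < f i z ↔ 0 < f i x ∨ f i x = 0 ∧ 0 < f i d) := by
  obtain ⟨t, ht, h⟩ := exists_pos_smul_step f x d
  refine ⟨x + t • d, fun i => ?_⟩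
  rcases lt_trichotomy (f i x) 0 with hx | hx | hx
  · have h1 := (h i).1 hx
    simp only [hx, h1, hx.ne, hx.not_gt, h1.not_gt, false_and, or_false, and_self]
  · simp [hx, mul_neg_iff, ht, ht.not_gt]
  · have h1 := (h i).2 hx
    simp only [hx, h1, hx.ne', hx.not_gt, h1.not_gt, false_and, or_false, and_self]

theorem isRegionPoint_of_composition {f : ι → V →ₗ[ℝ] ℝ} {x d z : V} (hd : IsRegionPoint f d)
    (h : ∀ i, (f i z < 0 ↔ f i x < 0 ∨ f i x = 0 ∧ f i d < 0) ∧
      (0 < f i z ↔ 0 < f i x ∨ f i x = 0 ∧ 0 < f i d)) : IsRegionPoint f z := by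
  intro i
  rcases lt_trichotomy (f i x) 0 with h0 | h0 | h0
  · exact ((h i).1.2 (Or.inl h0)).ne
  · rcases lt_or_gt_of_ne (hd i) with h1 | h1
    · exact ((h i).1.2 (Or.inr ⟨h0, h1⟩)).ne
    · exact ((h i).2.2 (Or.inr ⟨h0, h1⟩)).ne'
  · exact ((h i).2.2 (Or.inl h0)).ne'

/-! ### Convexity and extreme rays -/

/-- If the image of a convex set under finitely many functionals meets every open orthant, then it
contains the origin. -/
theorem exists_forall_eq_zero_of_orthants (f : ι → V →ₗ[ℝ] ℝ) (J : Finset ι) :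
    ∀ D : Set V, Convex ℝ D →
      (∀ K : Set ι, ∃ v ∈ D, ∀ i ∈ J, (i ∈ K → 0 < f i v) ∧ (i ∉ K → f i v < 0)) →
      ∃ v ∈ D, ∀ i ∈ J, f i v = 0 := by
  classical
  induction J using Finset.induction_on with
  | empty =>
    intro D _ h
    obtain ⟨v, hv, _⟩ := h ∅
    exact ⟨v, hv, by simp⟩
  | insert a J ha ih =>
    intro D hD h
    obtain ⟨v, ⟨hvD, hva⟩, hv⟩ := ih (D ∩ {v | f a v = 0})
      (hD.inter (by
        intro x hx y hy s t _ _ _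
        simp only [Set.mem_ofPred_eq] at hx hy ⊢
        simp [hx, hy])) (by
      intro K
      obtain ⟨p, hpD, hp⟩ := h (K ∪ {a})
      obtain ⟨q, hqD, hq⟩ := h (K \ {a})
      have hpa : 0 < f a p := (hp a (Finset.mem_insert_self a J)).1 (by simp)
      have hqa : f a q < 0 := (hq a (Finset.mem_insert_self a J)).2 (by simp)
      -- the point of the segment from `p` to `q` on which `f a` vanishes
      have hd : 0 < f a p - f a q := by linarith
      refine ⟨(-f a q / (f a p - f a q)) • p + (f a p / (f a p - f a q)) • q,
        ⟨hD hpD hqD (div_nonneg (by linarith) hd.le) (div_nonneg hpa.le hd.le)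
          (by field_simp; ring), ?_⟩, ?_⟩
      · simp only [Set.mem_ofPred_eq, map_add, map_smul, smul_eq_mul]
        field_simp
        ring
      · intro i hi
        have hia : i ≠ a := fun h => ha (h ▸ hi)
        have h1 : 0 < -f a q / (f a p - f a q) := div_pos (by linarith) hd
        have h2 : 0 < f a p / (f a p - f a q) := div_pos hpa hd
        have hpi := hp i (Finset.mem_insert_of_mem hi)
        have hqi := hq i (Finset.mem_insert_of_mem hi)
        simp only [map_add, map_smul, smul_eq_mul]
        constructor
        · intro hK
          have h3 := mul_pos h1 (hpi.1 (Or.inl hK))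
          have h4 := mul_pos h2 (hqi.1 ⟨hK, hia⟩)
          linarith
        · intro hK
          have h3 := mul_neg_of_pos_of_neg h1 (hpi.2 (by simp [hK, hia]))
          have h4 := mul_neg_of_pos_of_neg h2 (hqi.2 (by simp [hK]))
          linarith)
    refine ⟨v, hvD, fun i hi => ?_⟩
    rcases Finset.mem_insert.1 hi with rfl | hi
    · exact hva
    · exact hv i hi

/-- The set `I` consists of the elements of `Z` that span extreme rays of the cone generated by the
functionals in `N ∪ Z`. The first property says, in dual form, that `Z` lies in the cone generated
by `N ∪ I`; the second one that each `i ∈ I` is exposed. -/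
theorem exists_extreme_generators [Finite ι] (f : ι → V →ₗ[ℝ] ℝ) {b : V} (hb : ∀ i, 0 < f i b)
    (hf : ∀ i j, i ≠ j → ∃ d, f i d = 0 ∧ 0 < f j d) (N Z : Set ι) :
    ∃ I ⊆ Z, (∀ v, (∀ i ∈ N, f i v ≤ 0) → (∀ i ∈ I, f i v ≤ 0) → ∀ i ∈ Z, f i v ≤ 0) ∧
      ∀ i ∈ I, ∃ v, f i v = 0 ∧ ∀ j ∈ N ∪ Z, j ≠ i → f j v < 0 := by
  obtain ⟨I, hI⟩ := (Set.toFinite {I : Set ι | I ⊆ Z ∧ ∀ v, (∀ i ∈ N, f i v ≤ 0) →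
    (∀ i ∈ I, f i v ≤ 0) → ∀ i ∈ Z, f i v ≤ 0}).exists_minimal
    ⟨Z, subset_rfl, fun v _ h => h⟩
  obtain ⟨hIZ, hG⟩ := hI.prop
  refine ⟨I, hIZ, hG, fun i hi => ?_⟩
  have hne : ¬ ∀ v, (∀ j ∈ N, f j v ≤ 0) → (∀ j ∈ I \ {i}, f j v ≤ 0) → ∀ j ∈ Z, f j v ≤ 0 := by
    intro h
    exact (hI.le_of_le (y := I \ {i}) ⟨Set.sdiff_subset.trans hIZ, h⟩ Set.sdiff_subset hi).2 rfl
  push Not at hne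
  obtain ⟨v, hvN, hvI, e, he, hve⟩ := hne
  have hvi : 0 < f i v := by
    by_contra hneg
    refine absurd (hG v hvN (fun j hj => ?_) e he) hve.not_ge
    by_cases hji : j = i
    · subst hji; exact not_lt.1 hneg
    · exact hvI j ⟨hj, hji⟩
  -- move `v` in the direction `-b` until the functional `i` vanishes
  have hs : 0 < f i v / f i b := div_pos hvi (hb i)
  have hlt : ∀ j, f j v ≤ 0 → f j (v - (f i v / f i b) • b) < 0 := by
    intro j hj
    have := mul_pos hs (hb j)
    simp only [map_sub, map_smul, smul_eq_mul]
    linarith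
  have h0 : f i (v - (f i v / f i b) • b) = 0 := by
    have := (hb i).ne'
    simp only [map_sub, map_smul, smul_eq_mul]
    field_simp
    ring
  refine ⟨v - (f i v / f i b) • b, h0, ?_⟩
  rintro j (hj | hj) hji
  · exact hlt j (hvN j hj)
  · by_contra hneg
    push Not at hneg
    obtain ⟨d, hdi, hdj⟩ := hf i j hji.symm
    obtain ⟨t, ht, hstep⟩ := exists_pos_smul_step f (v - (f i v / f i b) • b) d
    have hle := hG (v - (f i v / f i b) • b + t • d)
      (fun k hk => ((hstep k).1 (hlt k (hvN k hk))).le) (fun k hk => by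
        by_cases hki : k = i
        · subst hki
          rw [map_add, h0, map_smul, hdi]
          simp
        · exact ((hstep k).1 (hlt k (hvI k ⟨hk, hki⟩))).le) j hj
    have := mul_pos ht hdj
    rw [map_add, map_smul, smul_eq_mul] at hle
    linarith

/-! ### Joins in the facial weak order of points -/

theorem exists_finite_meet {κ : Type*} (f : ι → V →ₗ[ℝ] ℝ)
    (hinf : ∀ x y, IsRegionPoint f x → IsRegionPoint f y → ∃ z, IsRegionPoint f z ∧
      ∀ u, IsRegionPoint f u → (RegionLE f u z ↔ RegionLE f u x ∧ RegionLE f u y))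
    {M : V} (hM : IsRegionPoint f M) (T : κ → V) (K : Finset κ)
    (hT : ∀ i ∈ K, IsRegionPoint f (T i)) :
    ∃ R, IsRegionPoint f R ∧ ∀ u, IsRegionPoint f u →
      (RegionLE f u R ↔ RegionLE f u M ∧ ∀ i ∈ K, RegionLE f u (T i)) := by
  classical
  induction K using Finset.induction_on with
  | empty => exact ⟨M, hM, fun u _ => by simp⟩
  | insert a K ha ih =>
    obtain ⟨R, hR, h⟩ := ih fun i hi => hT i (Finset.mem_insert_of_mem hi)
    obtain ⟨R', hR', h'⟩ := hinf R (T a) hR (hT a (Finset.mem_insert_self a K))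
    refine ⟨R', hR', fun u hu => ?_⟩
    rw [h' u hu, h u hu, Finset.forall_mem_insert]
    tauto

/-- If the regions form a lattice, then any two points have a join for `FaceLE`. Writing `N` for the
functionals negative at one of the points and `Z` for the others that vanish at one of them, the
join is a point that is negative on `N`, zero on the extreme elements of `Z`, and positive wherever
the join `M` of the upper regions of the two points is positive. -/
theorem exists_faceLE_join [Finite ι] (f : ι → V →ₗ[ℝ] ℝ) {b : V} (hb : ∀ i, 0 < f i b)
    (hf : ∀ i j, i ≠ j → ∃ d, f i d = 0 ∧ 0 < f j d)
    (hsup : ∀ x y, IsRegionPoint f x → IsRegionPoint f y → ∃ z, IsRegionPoint f z ∧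
      ∀ u, IsRegionPoint f u → (RegionLE f z u ↔ RegionLE f x u ∧ RegionLE f y u))
    (hinf : ∀ x y, IsRegionPoint f x → IsRegionPoint f y → ∃ z, IsRegionPoint f z ∧
      ∀ u, IsRegionPoint f u → (RegionLE f u z ↔ RegionLE f u x ∧ RegionLE f u y))
    (x : Bool → V) :
    ∃ w, ∀ y, FaceLE f w y ↔ ∀ c, FaceLE f (x c) y := by
  classical
  have hb' : ∀ i, f i (-b) < 0 := fun i => by rw [map_neg]; linarith [hb i]
  set N : Set ι := {i | ∃ c, f i (x c) < 0}
  set Z : Set ι := {i | i ∉ N ∧ ∃ c, f i (x c) = 0}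
  have hnonneg : ∀ i ∉ N, ∀ c, 0 ≤ f i (x c) := fun i hi c => not_lt.1 fun h => hi ⟨c, h⟩
  have hpos : ∀ i, i ∉ N → i ∉ Z → ∀ c, 0 < f i (x c) := fun i hi hi' c =>
    lt_of_le_of_ne (hnonneg i hi c) fun h => hi' ⟨hi, c, h.symm⟩
  have hNZ : ∀ i c, f i (x c) ≤ 0 → i ∈ N ∪ Z := by
    intro i c h
    by_contra hneg
    rw [Set.mem_union, not_or] at hneg
    exact absurd (hpos i hneg.1 hneg.2 c) h.not_gt
  -- upper bounds are the points that are negative on `N` and nonpositive on `Z`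
  have hub : ∀ y, (∀ c, FaceLE f (x c) y) ↔ (∀ i ∈ N, f i y < 0) ∧ ∀ i ∈ Z, f i y ≤ 0 := by
    intro y
    constructor
    · intro h
      exact ⟨fun i ⟨c, hc⟩ => (h c i).1 hc, fun i ⟨_, c, hc⟩ => (h c i).2 hc.le⟩
    · rintro ⟨h1, h2⟩ c i
      refine ⟨fun h => h1 i ⟨c, h⟩, fun h => ?_⟩
      rcases hNZ i c h with hi | hi
      · exact (h1 i hi).le
      · exact h2 i hi
  -- `m c` and `U c` represent the least and the greatest region around `x c`
  choose m hm using fun c => exists_composition f (x c) b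
  choose U hU using fun c => exists_composition f (x c) (-b)
  have hmneg : ∀ c i, f i (m c) < 0 ↔ f i (x c) < 0 := fun c i => by
    rw [(hm c i).1]; simp [(hb i).not_gt]
  have hUneg : ∀ c i, f i (U c) < 0 ↔ f i (x c) ≤ 0 := fun c i => by
    rw [(hU c i).1, le_iff_lt_or_eq]; simp only [hb' i, and_true]
  have gb : IsRegionPoint f b := fun i => (hb i).ne'
  have gb' : IsRegionPoint f (-b) := fun i => (hb' i).ne
  have gm : ∀ c, IsRegionPoint f (m c) := fun c => isRegionPoint_of_composition gb (hm c)
  have gU : ∀ c, IsRegionPoint f (U c) := fun c => isRegionPoint_of_composition gb' (hU c)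
  obtain ⟨M, gM, hM⟩ := hsup (U false) (U true) (gU _) (gU _)
  have hMU : ∀ u, IsRegionPoint f u → (RegionLE f M u ↔ ∀ i ∈ N ∪ Z, f i u < 0) := by
    intro u hu
    rw [hM u hu]
    constructor
    · rintro ⟨h1, h2⟩ i hi
      have : ∃ c, f i (x c) ≤ 0 := by
        rcases hi with ⟨c, hc⟩ | ⟨_, c, hc⟩
        · exact ⟨c, hc.le⟩
        · exact ⟨c, hc.le⟩
      obtain ⟨c, hc⟩ := this
      cases c
      · exact h1 i ((hUneg _ i).2 hc)
      · exact h2 i ((hUneg _ i).2 hc)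
    · intro h
      exact ⟨fun i hi => h i (hNZ i _ ((hUneg _ i).1 hi)),
        fun i hi => h i (hNZ i _ ((hUneg _ i).1 hi))⟩
  have hMneg : ∀ i ∈ N ∪ Z, f i M < 0 := (hMU M gM).1 fun _ h => h
  -- every upper bound is nonpositive on the separation set of `M`
  have hle : ∀ y, (∀ i ∈ N, f i y < 0) → (∀ i ∈ Z, f i y ≤ 0) → ∀ i, f i M < 0 → f i y ≤ 0 := by
    intro y h1 h2 i hi
    obtain ⟨u, hu⟩ := exists_composition f y (-b)
    have huneg : ∀ i, f i u < 0 ↔ f i y ≤ 0 := fun i => by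
      rw [(hu i).1, le_iff_lt_or_eq]; simp only [hb' i, and_true]
    refine (huneg i).1 ((hMU u (isRegionPoint_of_composition gb' hu)).2
      (fun j hj => (huneg j).2 ?_) i hi)
    rcases hj with hj | hj
    · exact (h1 j hj).le
    · exact h2 j hj
  obtain ⟨I, hIZ, hG, hI⟩ := exists_extreme_generators f hb hf N Z
  choose! v hv0 hv using hI
  choose T hT using fun i => exists_composition f (v i) b
  have gT : ∀ i, IsRegionPoint f (T i) := fun i => isRegionPoint_of_composition gb (hT i)
  have hTpos : ∀ i ∈ I, 0 < f i (T i) := fun i hi => ((hT i i).2).2 (Or.inr ⟨hv0 i hi, hb i⟩)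
  have hTneg : ∀ i ∈ I, ∀ j ∈ N ∪ Z, j ≠ i → f j (T i) < 0 := fun i hi j hj hji =>
    ((hT i j).1).2 (Or.inl (hv i hi j hj hji))
  -- the join has to vanish on `I`; it is found by convexity from regions with all signs on `I`
  obtain ⟨w, ⟨hwN, hwM⟩, hwI⟩ := exists_forall_eq_zero_of_orthants f (Set.toFinite I).toFinset
      {w | (∀ i ∈ N, f i w < 0) ∧ ∀ i, 0 < f i M → 0 < f i w} (by
    have h : {w | (∀ i ∈ N, f i w < 0) ∧ ∀ i, 0 < f i M → 0 < f i w} =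
        (⋂ i ∈ N, {w | f i w < 0}) ∩ ⋂ i ∈ {i | 0 < f i M}, {w | 0 < f i w} := by
      ext w; simp
    rw [h]
    exact (convex_iInter₂ fun i _ => convex_halfSpace_lt (f i).isLinear 0).inter
      (convex_iInter₂ fun i _ => convex_halfSpace_gt (f i).isLinear 0)) (by
    intro K
    obtain ⟨R, gR, hR⟩ := exists_finite_meet f hinf gM T (Set.toFinite (I ∩ K)).toFinset
      fun i _ => gT i
    simp only [Set.Finite.mem_toFinset] at hR
    obtain ⟨hRM, hRT⟩ := (hR R gR).1 fun _ h => h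
    refine ⟨R, ⟨?_, ?_⟩, ?_⟩
    · rintro i ⟨c, hc⟩
      refine (hR (m c) (gm c)).2 ⟨fun j hj => hMneg j (Or.inl ⟨c, (hmneg c j).1 hj⟩), ?_⟩ i
        ((hmneg c i).2 hc)
      intro k hk j hj
      have hjN : j ∈ N := ⟨c, (hmneg c j).1 hj⟩
      exact hTneg k hk.1 j (Or.inl hjN) fun h => (hIZ hk.1).1 (h ▸ hjN)
    · intro i hi
      exact lt_of_le_of_ne (not_lt.1 fun h => hi.not_gt (hRM i h)) (gR i).symm
    · intro j hj
      rw [Set.Finite.mem_toFinset] at hj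
      refine ⟨fun hjK => ?_, fun hjK => ?_⟩
      · exact lt_of_le_of_ne (not_lt.1 fun h => (hTpos j hj).not_gt (hRT j ⟨hj, hjK⟩ j h))
          (gR j).symm
      · -- a region next to a point `x c` on the hyperplane `j`, on the side away from `T j`
        obtain ⟨c, hc⟩ := (hIZ hj).2
        obtain ⟨Q, hQ⟩ := exists_composition f (x c) (-T j)
        have gQ : IsRegionPoint f Q :=
          isRegionPoint_of_composition (fun i => by rw [map_neg]; exact neg_ne_zero.2 (gT j i)) hQ
        have hQneg : ∀ i, f i Q < 0 ↔ f i (x c) < 0 ∨ f i (x c) = 0 ∧ 0 < f i (T j) := fun i => by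
          rw [(hQ i).1, map_neg, neg_lt_zero]
        refine (hR Q gQ).2 ⟨fun i hi => ?_, fun k hk i hi => ?_⟩ j
          ((hQneg j).2 (Or.inr ⟨hc, hTpos j hj⟩))
        · refine hMneg i (hNZ i c ?_)
          rcases (hQneg i).1 hi with h | h
          · exact h.le
          · exact h.1.le
        · have hiNZ : i ∈ N ∪ Z := by
            refine hNZ i c ?_
            rcases (hQneg i).1 hi with h | h
            · exact h.le
            · exact h.1.le
          refine hTneg k hk.1 i hiNZ ?_
          rintro rfl
          rcases (hQneg i).1 hi with h | h
          · exact (hIZ hk.1).1 ⟨c, h⟩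
          · exact (hTneg j hj i hiNZ fun hij => hjK (hij ▸ hk.2)).not_gt h.2)
  simp only [Set.Finite.mem_toFinset] at hwI
  have hwZ := hG w (fun i hi => (hwN i hi).le) fun i hi => (hwI i hi).le
  refine ⟨w, fun y => ⟨fun h => ?_, fun h => ?_⟩⟩
  · rw [hub]
    exact ⟨fun i hi => (h i).1 (hwN i hi), fun i hi => (h i).2 (hwZ i hi)⟩
  · obtain ⟨hyN, hyZ⟩ := (hub y).1 h
    have hle0 : ∀ i, f i w ≤ 0 → f i M < 0 := fun i hi =>
      lt_of_le_of_ne (not_lt.1 fun h => hi.not_gt (hwM i h)) (gM i)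
    refine fun i => ⟨fun hi => ?_, fun hi => hle y hyN hyZ i (hle0 i hi)⟩
    -- a little beyond `y` on the ray from `w` is again an upper bound
    obtain ⟨t, ht, hstep⟩ := exists_pos_smul_step f y (y - w)
    have hN' : ∀ j ∈ N, f j (y + t • (y - w)) < 0 := fun j hj => (hstep j).1 (hyN j hj)
    have hZ' := hG (y + t • (y - w)) (fun j hj => (hN' j hj).le) fun j hj => by
      have h1 := hyZ j (hIZ hj)
      have h2 := mul_nonpos_of_nonneg_of_nonpos ht.le h1
      simp only [map_add, map_smul, map_sub, smul_eq_mul, hwI j hj]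
      linarith
    have hfin := hle _ hN' hZ' i (hle0 i hi.le)
    have h1 := mul_neg_of_pos_of_neg ht hi
    simp only [map_add, map_smul, map_sub, smul_eq_mul] at hfin
    by_contra hneg
    have h2 := mul_nonneg ht.le (not_lt.1 hneg)
    linarith

/-- The antipodal map reverses `FaceLE`, which turns joins into meets. -/
theorem faceLE_neg_iff (f : ι → V →ₗ[ℝ] ℝ) (x y : V) :
    FaceLE f (-x) (-y) ↔ FaceLE f y x := by
  have key : ∀ x y : V, FaceLE f y x → FaceLE f (-x) (-y) := by
    intro x y h i
    simp only [map_neg, neg_lt_zero, neg_nonpos]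
    exact ⟨fun hi => not_le.1 fun hy => absurd ((h i).2 hy) hi.not_ge,
      fun hi => not_lt.1 fun hy => absurd ((h i).1 hy) hi.not_gt⟩
  refine ⟨fun h => ?_, key x y⟩
  have := key _ _ h
  rwa [neg_neg, neg_neg] at this

end SignOrder

/-! ### Faces and regions of an arrangement as points -/

namespace CentralArrangement

section Points

variable {V : Type*} [NormedAddCommGroup V] [InnerProductSpace ℝ V] [FiniteDimensional ℝ V]

/-- The linear functionals that define the hyperplanes of `A`, scaled so as to be positive at the
point `b` of the complement. -/
noncomputable def orientedFunctional (A : CentralArrangement V) (b : V) (H : A.hyperplanes) :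
    V →ₗ[ℝ] ℝ := A.nf H b • (A.nf H : V →ₗ[ℝ] ℝ)

theorem orientedFunctional_apply (A : CentralArrangement V) (b : V) (H : A.hyperplanes) (x : V) :
    A.orientedFunctional b H x = A.nf H b * A.nf H x := rfl

theorem orientedFunctional_self_pos (A : CentralArrangement V) {b : V} (hb : b ∈ A.complement)
    (H : A.hyperplanes) : 0 < A.orientedFunctional b H b :=
  mul_self_pos.2 (A.mem_complement_iff.1 hb H H.2)

theorem isRegionPoint_iff (A : CentralArrangement V) {b : V} (hb : b ∈ A.complement) {x : V} :
    IsRegionPoint (A.orientedFunctional b) x ↔ x ∈ A.complement := by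
  rw [mem_complement_iff]
  constructor
  · exact fun h H hH h0 => h ⟨H, hH⟩ (by rw [orientedFunctional_apply, h0, mul_zero])
  · exact fun h H => mul_ne_zero (A.mem_complement_iff.1 hb H H.2) (h H H.2)

/-- Two distinct hyperplanes are not nested, so that each has a point on a given side of the
other. -/
theorem exists_orientedFunctional_eq_zero_pos (A : CentralArrangement V) {b : V}
    (hb : b ∈ A.complement) (H K : A.hyperplanes) (hHK : H ≠ K) :
    ∃ d, A.orientedFunctional b H d = 0 ∧ 0 < A.orientedFunctional b K d := by
  have hle : ¬ (H : Submodule ℝ V) ≤ K := fun h => hHK (Subtype.ext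
    (Submodule.eq_of_le_of_finrank_eq h
      (by have := A.isHyperplane H H.2; have := A.isHyperplane K K.2; omega)))
  obtain ⟨d, hdH, hdK⟩ := SetLike.not_le_iff_exists.1 hle
  have h0 : A.orientedFunctional b H d = 0 := by
    rw [orientedFunctional_apply, (A.nf_eq_zero_iff H.2 d).2 hdH, mul_zero]
  have h1 : A.orientedFunctional b K d ≠ 0 :=
    mul_ne_zero (A.mem_complement_iff.1 hb K K.2) fun h => hdK ((A.nf_eq_zero_iff K.2 d).1 h)
  rcases lt_or_gt_of_ne h1 with h | h
  · exact ⟨-d, by rw [map_neg, h0, neg_zero], by rw [map_neg]; linarith⟩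
  · exact ⟨d, h0, h⟩

theorem posetOfRegions_le_iff (A : CentralArrangement V) {B : A.Region} {b x z : V}
    (hb : b ∈ A.complement) (hB : B.1 = A.cell b) (hx : x ∈ A.complement) (hz : z ∈ A.complement)
    {R R' : A.PosetOfRegions B} (hR : R.1 = A.cell x) (hR' : R'.1 = A.cell z) :
    R ≤ R' ↔ RegionLE (A.orientedFunctional b) x z := by
  refine (A.sepSet_subset_iff hb hx hz hB hR hR').trans ?_
  exact ⟨fun h H => h H H.2, fun h H hH => h ⟨H, hH⟩⟩

/-- The region represented by a point of the complement. -/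
def regionOf (A : CentralArrangement V) (B : A.Region) (x : V) (hx : x ∈ A.complement) :
    A.PosetOfRegions B := (⟨A.cell x, A.isRegion_iff.2 ⟨x, hx, rfl⟩⟩ : A.Region)

theorem exists_regionLE_sup (A : CentralArrangement V) {B : A.Region}
    (hL : IsLatticePoset (A.PosetOfRegions B)) {b : V} (hb : b ∈ A.complement)
    (hB : B.1 = A.cell b) (x y : V) (hx : IsRegionPoint (A.orientedFunctional b) x)
    (hy : IsRegionPoint (A.orientedFunctional b) y) :
    ∃ z, IsRegionPoint (A.orientedFunctional b) z ∧ ∀ u, IsRegionPoint (A.orientedFunctional b) u →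
      (RegionLE (A.orientedFunctional b) z u ↔
        RegionLE (A.orientedFunctional b) x u ∧ RegionLE (A.orientedFunctional b) y u) := by
  rw [A.isRegionPoint_iff hb] at hx hy
  obtain ⟨J, hJ⟩ := (hL (A.regionOf B x hx) (A.regionOf B y hy)).1
  obtain ⟨z, hz, hJz⟩ := A.isRegion_iff.1 J.2
  refine ⟨z, (A.isRegionPoint_iff hb).2 hz, fun u hu => ?_⟩
  rw [A.isRegionPoint_iff hb] at hu
  rw [← A.posetOfRegions_le_iff (R' := A.regionOf B u hu) hb hB hz hu hJz rfl,
    ← A.posetOfRegions_le_iff (R := A.regionOf B x hx) (R' := A.regionOf B u hu) hb hB hx hu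
      rfl rfl,
    ← A.posetOfRegions_le_iff (R := A.regionOf B y hy) (R' := A.regionOf B u hu) hb hB hy hu
      rfl rfl, isLUB_le_iff hJ]
  simp [upperBounds]

theorem exists_regionLE_inf (A : CentralArrangement V) {B : A.Region}
    (hL : IsLatticePoset (A.PosetOfRegions B)) {b : V} (hb : b ∈ A.complement)
    (hB : B.1 = A.cell b) (x y : V) (hx : IsRegionPoint (A.orientedFunctional b) x)
    (hy : IsRegionPoint (A.orientedFunctional b) y) :
    ∃ z, IsRegionPoint (A.orientedFunctional b) z ∧ ∀ u, IsRegionPoint (A.orientedFunctional b) u →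
      (RegionLE (A.orientedFunctional b) u z ↔
        RegionLE (A.orientedFunctional b) u x ∧ RegionLE (A.orientedFunctional b) u y) := by
  rw [A.isRegionPoint_iff hb] at hx hy
  obtain ⟨J, hJ⟩ := (hL (A.regionOf B x hx) (A.regionOf B y hy)).2
  obtain ⟨z, hz, hJz⟩ := A.isRegion_iff.1 J.2
  refine ⟨z, (A.isRegionPoint_iff hb).2 hz, fun u hu => ?_⟩
  rw [A.isRegionPoint_iff hb] at hu
  rw [← A.posetOfRegions_le_iff (R := A.regionOf B u hu) hb hB hu hz rfl hJz,
    ← A.posetOfRegions_le_iff (R := A.regionOf B u hu) (R' := A.regionOf B x hx) hb hB hu hx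
      rfl rfl,
    ← A.posetOfRegions_le_iff (R := A.regionOf B u hu) (R' := A.regionOf B y hy) hb hB hu hy
      rfl rfl, le_isGLB_iff hJ]
  simp [lowerBounds]

/-- The point `p` represents the face `F`: the regions that contain `p` are exactly those that
contain `F`. For a face this means that `p` lies in its relative interior. -/
def IsFacePoint (A : CentralArrangement V) (p : V) (F : A.Face) : Prop :=
  ∀ z ∈ A.complement, F.1 ⊆ A.cell z ↔ p ∈ A.cell z

theorem exists_isFacePoint (A : CentralArrangement V) (F : A.Face) : ∃ p, A.IsFacePoint p F := by
  obtain ⟨p, hp⟩ := A.exists_generic F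
  exact ⟨p, fun z _ => hp z⟩

/-- Moving a little from `p` in a direction off all hyperplanes leads into a region around `p`. -/
theorem exists_mem_cell_of_composition (A : CentralArrangement V) {b : V} (hb : b ∈ A.complement)
    (p : V) {d : V} (hd : d ∈ A.complement) : ∃ z ∈ A.complement, p ∈ A.cell z ∧
      ∀ H : A.hyperplanes, A.orientedFunctional b H p = 0 →
        (A.orientedFunctional b H z < 0 ↔ A.orientedFunctional b H d < 0) := by
  obtain ⟨z, hz⟩ := exists_composition (A.orientedFunctional b) p d
  refine ⟨z, (A.isRegionPoint_iff hb).1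
    (isRegionPoint_of_composition ((A.isRegionPoint_iff hb).2 hd) hz), fun H hH => ?_,
    fun H hp => ?_⟩
  · have hb0 := A.mem_complement_iff.1 hb H hH
    have key : 0 ≤ A.orientedFunctional b ⟨H, hH⟩ z * A.orientedFunctional b ⟨H, hH⟩ p := by
      rcases lt_trichotomy (A.orientedFunctional b ⟨H, hH⟩ p) 0 with h | h | h
      · exact (mul_pos_of_neg_of_neg ((hz _).1.2 (Or.inl h)) h).le
      · rw [h, mul_zero]
      · exact (mul_pos ((hz _).2.2 (Or.inl h)) h).le
    simp only [orientedFunctional_apply] at key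
    refine nonneg_of_mul_nonneg_right (a := A.nf H b * A.nf H b) ?_ (mul_self_pos.2 hb0)
    linarith
  · rw [(hz H).1]
    simp [hp]

/-- Every point represents a face: the intersection of the regions that contain it. -/
theorem exists_face_of_point (A : CentralArrangement V) {b : V} (hb : b ∈ A.complement) (p : V) :
    ∃ F : A.Face, A.IsFacePoint p F := by
  refine ⟨⟨⋂₀ {R | A.IsRegion R ∧ p ∈ R}, {R | A.IsRegion R ∧ p ∈ R}, ?_, fun R h => h.1, rfl⟩,
    fun z hz => ⟨fun h => h fun R hR => hR.2, fun h => ?_⟩⟩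
  · obtain ⟨z, hz, hpz, _⟩ := A.exists_mem_cell_of_composition hb p hb
    exact ⟨A.cell z, A.isRegion_iff.2 ⟨z, hz, rfl⟩, hpz⟩
  · exact Set.sInter_subset_of_mem ⟨A.isRegion_iff.2 ⟨z, hz, rfl⟩, h⟩

theorem orientedFunctional_neg_of_mem_cell (A : CentralArrangement V) {b z p : V}
    (hb : b ∈ A.complement) (hz : z ∈ A.complement) (hp : p ∈ A.cell z) (H : A.hyperplanes)
    (h0 : A.orientedFunctional b H p ≠ 0) :
    A.orientedFunctional b H z < 0 ↔ A.orientedFunctional b H p < 0 := by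
  have h1 := hp H H.2
  have h2 : A.orientedFunctional b H z ≠ 0 := (A.isRegionPoint_iff hb).2 hz H
  have h3 : 0 ≤ A.orientedFunctional b H z * A.orientedFunctional b H p := by
    have := mul_nonneg (mul_self_nonneg (A.nf H b)) h1
    simp only [orientedFunctional_apply]
    linarith
  constructor
  · intro h
    by_contra hneg
    exact absurd h3 (mul_neg_of_neg_of_pos h (lt_of_le_of_ne (not_lt.1 hneg) h0.symm)).not_ge
  · intro h
    by_contra hneg
    exact absurd h3 (mul_neg_of_pos_of_neg (lt_of_le_of_ne (not_lt.1 hneg) h2.symm) h).not_ge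

/-- The region `m_F` lies on the negative side of the hyperplanes for which `F` does. -/
theorem orientedFunctional_lower_neg_iff (A : CentralArrangement V) {B : A.Region} {b p z : V}
    (hb : b ∈ A.complement) (hB : B.1 = A.cell b) {F : A.Face} (hp : A.IsFacePoint p F)
    (hz : z ∈ A.complement) (hFz : (A.lower B F).1 = A.cell z) (H : A.hyperplanes) :
    A.orientedFunctional b H z < 0 ↔ A.orientedFunctional b H p < 0 := by
  have hl := (A.exists_isLeast B F).choose_spec
  have hpz : p ∈ A.cell z := (hp z hz).1 (hFz ▸ hl.1)
  by_cases h0 : A.orientedFunctional b H p = 0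
  · obtain ⟨u, hu, hpu, hu0⟩ := A.exists_mem_cell_of_composition hb p hb
    have hle : A.lower B F ≤ A.regionOf B u hu := hl.2 ((hp u hu).2 hpu)
    rw [A.posetOfRegions_le_iff hb hB hz hu hFz rfl] at hle
    constructor
    · exact fun h => absurd ((hu0 H h0).1 (hle H h)) (A.orientedFunctional_self_pos hb H).not_gt
    · exact fun h => absurd h0 h.ne
  · exact A.orientedFunctional_neg_of_mem_cell hb hz hpz H h0

/-- The region `M_F` lies on the negative side of the hyperplanes for which `F` does and of those
that contain `F`. -/
theorem orientedFunctional_upper_neg_iff (A : CentralArrangement V) {B : A.Region} {b p z : V}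
    (hb : b ∈ A.complement) (hB : B.1 = A.cell b) {F : A.Face} (hp : A.IsFacePoint p F)
    (hz : z ∈ A.complement) (hFz : (A.upper B F).1 = A.cell z) (H : A.hyperplanes) :
    A.orientedFunctional b H z < 0 ↔ A.orientedFunctional b H p ≤ 0 := by
  have hl := (A.exists_isGreatest B F).choose_spec
  have hpz : p ∈ A.cell z := (hp z hz).1 (hFz ▸ hl.1)
  by_cases h0 : A.orientedFunctional b H p = 0
  · have hb' : -b ∈ A.complement := by
      rw [mem_complement_iff] at hb ⊢
      exact fun H hH => by rw [map_neg]; exact neg_ne_zero.2 (hb H hH)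
    obtain ⟨u, hu, hpu, hu0⟩ := A.exists_mem_cell_of_composition hb p hb'
    have hle : A.regionOf B u hu ≤ A.upper B F := hl.2 ((hp u hu).2 hpu)
    rw [A.posetOfRegions_le_iff hb hB hu hz rfl hFz] at hle
    refine iff_of_true (hle H ((hu0 H h0).2 ?_)) h0.le
    rw [map_neg]
    linarith [A.orientedFunctional_self_pos hb H]
  · rw [A.orientedFunctional_neg_of_mem_cell hb hz hpz H h0]
    exact ⟨le_of_lt, fun h => lt_of_le_of_ne h h0⟩

theorem facialWeakOrder_le_iff (A : CentralArrangement V) {B : A.Region} {b p q : V}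
    (hb : b ∈ A.complement) (hB : B.1 = A.cell b) {F G : A.FacialWeakOrder B}
    (hp : A.IsFacePoint p F) (hq : A.IsFacePoint q G) :
    F ≤ G ↔ FaceLE (A.orientedFunctional b) p q := by
  obtain ⟨m, hm, hFm⟩ := A.isRegion_iff.1 (A.lower B F).2
  obtain ⟨M, hM, hFM⟩ := A.isRegion_iff.1 (A.upper B F).2
  obtain ⟨m', hm', hGm⟩ := A.isRegion_iff.1 (A.lower B G).2
  obtain ⟨M', hM', hGM⟩ := A.isRegion_iff.1 (A.upper B G).2
  change A.lower B F ≤ A.lower B G ∧ A.upper B F ≤ A.upper B G ↔ _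
  rw [A.posetOfRegions_le_iff hb hB hm hm' hFm hGm, A.posetOfRegions_le_iff hb hB hM hM' hFM hGM]
  simp only [RegionLE, FaceLE, A.orientedFunctional_lower_neg_iff hb hB hp hm hFm,
    A.orientedFunctional_lower_neg_iff hb hB hq hm' hGm,
    A.orientedFunctional_upper_neg_iff hb hB hp hM hFM,
    A.orientedFunctional_upper_neg_iff hb hB hq hM' hGM, forall_and]

end Points

end CentralArrangement

theorem mainTheorem1 {V : Type*} [NormedAddCommGroup V] [InnerProductSpace ℝ V]
    [FiniteDimensional ℝ V] (A : CentralArrangement V) (B : A.Region)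
    (hB : IsLatticePoset (A.PosetOfRegions B)) :
    IsLatticePoset (A.FacialWeakOrder B) := by
  obtain ⟨b, hb, hBb⟩ := A.isRegion_iff.1 B.2
  have hjoin := exists_faceLE_join (A.orientedFunctional b) (A.orientedFunctional_self_pos hb)
    (A.exists_orientedFunctional_eq_zero_pos hb) (A.exists_regionLE_sup hB hb hBb)
    (A.exists_regionLE_inf hB hb hBb)
  intro F G
  obtain ⟨p, hp⟩ := A.exists_isFacePoint F
  obtain ⟨q, hq⟩ := A.exists_isFacePoint G
  constructor
  · obtain ⟨w, hw⟩ := hjoin (fun c => cond c p q)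
    obtain ⟨J, hJ⟩ := A.exists_face_of_point hb w
    refine ⟨J, (isLUB_iff_le_iff).2 fun K => ?_⟩
    obtain ⟨y, hy⟩ := A.exists_isFacePoint K
    rw [A.facialWeakOrder_le_iff hb hBb hJ hy, hw]
    simp [upperBounds, A.facialWeakOrder_le_iff hb hBb hp hy,
      A.facialWeakOrder_le_iff hb hBb hq hy, and_comm]
  · obtain ⟨w, hw⟩ := hjoin (fun c => cond c (-p) (-q))
    obtain ⟨J, hJ⟩ := A.exists_face_of_point hb (-w)
    refine ⟨J, (isGLB_iff_le_iff).2 fun K => ?_⟩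
    obtain ⟨y, hy⟩ := A.exists_isFacePoint K
    rw [A.facialWeakOrder_le_iff hb hBb hy hJ, ← faceLE_neg_iff, neg_neg, hw]
    simp [lowerBounds, A.facialWeakOrder_le_iff hb hBb hy hp,
      A.facialWeakOrder_le_iff hb hBb hy hq, faceLE_neg_iff, and_comm]
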